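/- Let $K$ be a number field, let $r\ge 1$, and let $\alpha_1,\ldots,\alpha_r\in K^\times$ generate a multiplicative subgroup of $K^\times$ of rank $r$. Then there is an integer $B\ge 1$, depending only on $K$ and $\alpha_1,\ldots,\alpha_r$, such that for all positive integers $n,t_1,\ldots,t_r$ with $t_i\mid n$ for every $i$, for every primitive $n$-th root of unity $\zeta_n$ and every choice of roots $\alpha_i^{1/t_i}$ (that is, elements whose $t_i$-th power is $\alpha_i$) in an algebraic closure of $K$, the following hold: (1) the ratio $$\frac{\prod_{i=1}^r t_i}{\big[K(\zeta_n,\alpha_1^{1/t_1},\ldots,\alpha_r^{1/t_r}):K(\zeta_n)\big]}$$ is an integer and divides $B$; (2) with the same $B$, $$\big[K(\zeta_n,\alpha_1^{1/t_1},\ldots,\alpha_r^{1/t_r}):K\big]\;\ge\;\frac{\varphi(n)\prod_{i=1}^r t_i}{[K:\mathbb{Q}]\,B},$$ where $\varphi$ is Euler's totient function. -/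

import Mathlib

/-- The cyclotomic-Kummer field `K(ζ, β₁, …, βᵣ)` inside the algebraic closure of `K`.
It is used with `ζ` a primitive `n`-th root of unity and `βᵢ` a `tᵢ`-th root of `αᵢ`, so that it
is the field `K(ζₙ, α₁^(1/t₁), …, αᵣ^(1/tᵣ))`. -/
noncomputable def cyclotomicKummerField (K : Type*) [Field K] {r : ℕ}
    (ζ : AlgebraicClosure K) (β : Fin r → AlgebraicClosure K) :
    IntermediateField K (AlgebraicClosure K) :=
  IntermediateField.adjoin K (insert ζ (Set.range β))

/-- The degree `[K(ζ, β₁, …, βᵣ) : K(ζ)]`. -/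
noncomputable def kummerDegree (K : Type*) [Field K] {r : ℕ}
    (ζ : AlgebraicClosure K) (β : Fin r → AlgebraicClosure K) : ℕ :=
  IntermediateField.relfinrank (IntermediateField.adjoin K {ζ}) (cyclotomicKummerField K ζ β)

/-! Put L = K(ζ), F = L(β₁, …, βᵣ), w the number of roots of unity of K. Kummer theory embeds
Gal(F/L) in ∏ μ_{tᵢ}, so the degree divides ∏ tᵢ. For the reverse bound, suppose γ = ∏ βᵢ^eᵢ lies in
L. Then γⁿ is a product of powers of the αᵢ, and since L/K is abelian, its w-th power is cⁿ with c ∈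
K (`exists_pow_torsionOrder_eq_pow`). A uniform D puts c^D back in ⟨α⟩
(`NumberField.exists_pow_mem_of_pow_mem`), and independence of the αᵢ gives tᵢ ∣ m eᵢ with m = Dw.
Hence the Kummer characters χ^e, 0 ≤ eᵢ < tᵢ, coincide at most m^r to one, and ∏ tᵢ ≤ m^r [F : L].
-/

/-! ### Radicals in cyclotomic extensions. -/

/-- If `γ` lies in the cyclotomic extension generated by the `n`-th roots of unity and `γ ^ n = a` is
in the base number field `K`, then `a ^ w` is an `n`-th power in `K`, where `w` is the number of
roots of unity of `K`. -/
theorem exists_pow_torsionOrder_eq_pow {K L : Type*} [Field K] [NumberField K] [Field L]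
    [Algebra K L] [FiniteDimensional K L] [IsGalois K L] {n : ℕ} [NeZero n]
    [IsCyclotomicExtension {n} K L] {ζ : L} (hζ : IsPrimitiveRoot ζ n) {γ : L} {a : Kˣ}
    (hγ : γ ^ n = algebraMap K L a) :
    ∃ c : Kˣ, a ^ NumberField.Units.torsionOrder K = c ^ n := by
  have hn : n ≠ 0 := NeZero.ne n
  have hγ0 : γ ≠ 0 := by
    rintro rfl
    rw [zero_pow hn] at hγ
    exact a.ne_zero ((map_eq_zero (algebraMap K L)).1 hγ.symm)
  have hcomm (σ τ : L ≃ₐ[K] L) (x : L) : σ (τ x) = τ (σ x) := by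
    have : σ * τ = τ * σ := hζ.autToPow_injective K (by rw [map_mul, map_mul, mul_comm])
    exact DFunLike.congr_fun this x
  have hk (τ : L ≃ₐ[K] L) : ∃ k : ℕ, τ ζ = ζ ^ k := by
    obtain ⟨k, -, hk⟩ := hζ.eq_pow_of_pow_eq_one
      (ξ := τ ζ) (by rw [← map_pow, hζ.pow_eq_one, map_one])
    exact ⟨k, hk.symm⟩
  choose k hk using hk
  have hact (τ : L ≃ₐ[K] L) (x : L) (hx : x ^ n = 1) : τ x = x ^ k τ := by
    obtain ⟨i, -, rfl⟩ := hζ.eq_pow_of_pow_eq_one hx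
    rw [map_pow, hk, ← pow_mul, ← pow_mul, mul_comm]
  let J : AddSubgroup ℤ :=
    { carrier := {j | ∃ c : Kˣ, a ^ j = c ^ n}
      zero_mem' := ⟨1, by simp⟩
      add_mem' := by
        rintro i j ⟨c, hc⟩ ⟨d, hd⟩
        exact ⟨c * d, by rw [zpow_add, hc, hd, mul_pow]⟩
      neg_mem' := by
        rintro i ⟨c, hc⟩
        exact ⟨c⁻¹, by rw [zpow_neg, hc, inv_pow]⟩ }
  have hnJ : (n : ℤ) ∈ J := ⟨a, by simp⟩
  -- If σγ = εγ with εⁿ = 1, then σ(τγ) = τ(ε) τγ = ε^(k τ) τγ by commutativity, so γ^(k τ) / τγ is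
  -- fixed by every σ; its n-th power is a^(k τ - 1).
  have hkJ (τ : L ≃ₐ[K] L) : (k τ : ℤ) - 1 ∈ J := by
    have hfix (σ : L ≃ₐ[K] L) : σ (γ ^ k τ / τ γ) = γ ^ k τ / τ γ := by
      have hσ : σ γ = σ γ / γ * γ := by field_simp
      have h1 : (σ γ / γ) ^ n = 1 := by
        rw [div_pow, ← map_pow, hγ, AlgEquiv.commutes, div_self]
        simp
      have h2 : σ γ / γ ≠ 0 := div_ne_zero (by simpa using hγ0) hγ0
      rw [map_div₀, map_pow, hcomm σ τ, hσ, map_mul, hact τ _ h1, mul_pow,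
        mul_div_mul_left _ _ (pow_ne_zero _ h2)]
    obtain ⟨c, hc⟩ := (IsGalois.mem_range_algebraMap_iff_fixed _).2 hfix
    have hc0 : c ≠ 0 := by
      rintro rfl
      rw [map_zero, eq_comm] at hc
      exact div_ne_zero (pow_ne_zero _ hγ0) (by simpa using hγ0) hc
    refine ⟨Units.mk0 c hc0, Units.ext ((algebraMap K L).injective ?_)⟩
    have ha : algebraMap K L a ≠ 0 := by simp
    have hc' : algebraMap K L c ^ n = algebraMap K L a ^ k τ / algebraMap K L a := by
      rw [hc, div_pow, ← map_pow τ, pow_right_comm, hγ, AlgEquiv.commutes]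
    rw [Units.val_pow_eq_pow_val, Units.val_mk0, map_pow, hc', zpow_sub_one]
    simp [div_eq_mul_inv]
  obtain ⟨g, hg⟩ := Int.subgroup_cyclic J
  have hmem (j : ℤ) : j ∈ J ↔ (g.natAbs : ℤ) ∣ j := by
    rw [hg, AddSubgroup.mem_closure_singleton, Int.natAbs_dvd]
    exact ⟨fun ⟨i, hi⟩ ↦ ⟨i, by rw [← hi, smul_eq_mul, mul_comm]⟩,
      fun ⟨i, hi⟩ ↦ ⟨i, by rw [hi, smul_eq_mul, mul_comm]⟩⟩
  set d := g.natAbs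
  obtain ⟨m, hm⟩ : d ∣ n := Int.natCast_dvd_natCast.1 ((hmem _).1 hnJ)
  have hprim : IsPrimitiveRoot (ζ ^ m) d := hζ.pow (NeZero.pos n) (by rw [hm, mul_comm])
  have hd0 : NeZero d := ⟨by rintro h; rw [h, zero_mul] at hm; exact hn hm⟩
  -- `d` generates `J` and divides every k τ - 1, so this primitive d-th root of unity descends to
  -- K. Hence d divides w, that is, w ∈ `J`.
  have hfix (τ : L ≃ₐ[K] L) : τ (ζ ^ m) = ζ ^ m := by
    have h := (hprim.zpow_eq_one_iff_dvd _).2 ((hmem _).1 (hkJ τ))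
    rw [zpow_sub_one₀ (hprim.ne_zero hd0.out), zpow_natCast,
      mul_inv_eq_one₀ (hprim.ne_zero hd0.out)] at h
    rw [map_pow, hk, pow_right_comm, h]
  obtain ⟨ξ, hξ⟩ := (IsGalois.mem_range_algebraMap_iff_fixed _).2 hfix
  have hξ' : IsPrimitiveRoot ξ d :=
    IsPrimitiveRoot.of_map_of_injective (f := algebraMap K L) (by rwa [hξ])
      (algebraMap K L).injective
  have hdvd := NumberField.Units.dvd_torsionOrder_of_isPrimitiveRoot hξ'
  obtain ⟨c, hc⟩ := (hmem _).2 (Int.natCast_dvd_natCast.2 hdvd)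
  exact ⟨c, by simpa using hc⟩

/-! ### Saturation of finitely generated subgroups of Kˣ. -/

open IsDedekindDomain in
theorem IsDedekindDomain.HeightOneSpectrum.exists_unit_of_valuation_eq_one {R K : Type*}
    [CommRing R] [IsDedekindDomain R] [Field K] [Algebra R K] [IsFractionRing R K] {x : Kˣ}
    (hx : ∀ v : HeightOneSpectrum R, v.valuation K x = 1) :
    ∃ u : Rˣ, Units.map (algebraMap R K : R →* K) u = x := by
  obtain ⟨y, hy⟩ := HeightOneSpectrum.mem_integers_of_valuation_le_one K (x : K)
    fun v ↦ (hx v).le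
  obtain ⟨z, hz⟩ := HeightOneSpectrum.mem_integers_of_valuation_le_one K ((x⁻¹ : Kˣ) : K)
    fun v ↦ by rw [Units.val_inv_eq_inv_val, map_inv₀, hx v, inv_one]
  have hyz : y * z = 1 := IsFractionRing.injective R K (by
    rw [map_mul, hy, hz, map_one, Units.mul_inv])
  exact ⟨⟨y, z, hyz, by rw [mul_comm, hyz]⟩, Units.ext hy⟩

open IsDedekindDomain in
theorem IsDedekindDomain.HeightOneSpectrum.finite_setOf_valuation_ne_one {R K : Type*}
    [CommRing R] [IsDedekindDomain R] [Field K] [Algebra R K] [IsFractionRing R K] (x : Kˣ) :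
    {v : HeightOneSpectrum R | v.valuation K x ≠ 1}.Finite := by
  refine ((HeightOneSpectrum.Support.finite R (x : K)).union
    (HeightOneSpectrum.Support.finite R ((x⁻¹ : Kˣ) : K))).subset fun v hv ↦ ?_
  rcases lt_or_gt_of_ne hv with h | h
  · right
    show 1 < v.valuation K _
    rw [Units.val_inv_eq_inv_val, map_inv₀]
    exact (one_lt_inv₀ (zero_lt_iff.2 (by simp))).2 h
  · exact Or.inl h

open IsDedekindDomain NumberField in
/-- The elements of `Kˣ` some positive power of which lies in a finitely generated subgroup `G` have
bounded order modulo `G`. -/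
theorem NumberField.exists_pow_mem_of_pow_mem {K : Type*} [Field K] [NumberField K]
    {s : Set Kˣ} (hs : s.Finite) :
    ∃ D : ℕ, 0 < D ∧ ∀ (c : Kˣ) (n : ℕ), 0 < n → c ^ n ∈ Subgroup.closure s →
      c ^ D ∈ Subgroup.closure s := by
  set G := Subgroup.closure s
  let N : Submodule ℤ (Additive Kˣ) :=
    { carrier := {c | ∃ n : ℕ, 0 < n ∧ c.toMul ^ n ∈ G}
      zero_mem' := ⟨1, one_pos, by simp⟩
      add_mem' := by
        rintro x y ⟨m, hm, hx⟩ ⟨n, hn, hy⟩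
        refine ⟨m * n, Nat.mul_pos hm hn, ?_⟩
        rw [toMul_add, mul_pow, pow_mul, mul_comm m n, pow_mul]
        exact mul_mem (pow_mem hx n) (pow_mem hy m)
      smul_mem' := by
        rintro k x ⟨m, hm, hx⟩
        refine ⟨m, hm, ?_⟩
        rw [toMul_zsmul, ← zpow_natCast, zpow_comm, zpow_natCast]
        exact zpow_mem hx k }
  let S : Set (HeightOneSpectrum (𝓞 K)) := ⋃ x ∈ s, {v | v.valuation K (x : K) ≠ 1}
  have hS : S.Finite :=
    hs.biUnion fun x _ ↦ HeightOneSpectrum.finite_setOf_valuation_ne_one x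
  have : Finite S := hS
  have : Fintype S := Fintype.ofFinite S
  let f : Additive Kˣ →ₗ[ℤ] (S → ℤ) :=
    LinearMap.pi fun v ↦ (v.1.valuationOfNeZero (K := K)).toAdditiveLeft.toIntLinearMap
  -- The value group is torsion-free, so the saturation `N` has no more bad primes than the
  -- generators.
  have hout (v : HeightOneSpectrum (𝓞 K)) (hv : v ∉ S) (x : Additive Kˣ) (hx : x ∈ N) :
      v.valuation K (x.toMul : K) = 1 := by
    obtain ⟨m, hm, hx⟩ := hx
    have hG : G ≤ (v.valuationOfNeZero (K := K)).ker := by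
      refine (Subgroup.closure_le _).2 fun y hy ↦ ?_
      have : v.valuation K (y : K) = 1 := by
        by_contra h
        exact hv (Set.mem_biUnion hy h)
      rw [SetLike.mem_coe, MonoidHom.mem_ker, ← WithZero.coe_inj, v.valuationOfNeZero_eq, this]
      rfl
    have h := hG hx
    rw [MonoidHom.mem_ker, map_pow, pow_eq_one_iff, or_iff_left hm.ne'] at h
    rw [← v.valuationOfNeZero_eq, h]
    rfl
  -- The image of `N` lies in ℤ^S, and the kernel consists of units of 𝓞 K, a finitely generated
  -- group by Dirichlet's theorem.
  have hfg : N.FG := by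
    refine Submodule.fg_of_fg_map_of_fg_inf_ker f (IsNoetherian.noetherian _) ?_
    let g : Additive (𝓞 K)ˣ →ₗ[ℤ] Additive Kˣ :=
      (Units.map (algebraMap (𝓞 K) K : 𝓞 K →* K)).toAdditive.toIntLinearMap
    have hle : N ⊓ LinearMap.ker f ≤ LinearMap.range g := by
      rintro x ⟨hx, hxf⟩
      obtain ⟨u, hu⟩ := HeightOneSpectrum.exists_unit_of_valuation_eq_one (R := 𝓞 K)
        (x := x.toMul) (fun v ↦ by
          by_cases hv : v ∈ S
          · have h : (v.valuationOfNeZero (K := K)) x.toMul = 1 := congr_fun hxf ⟨v, hv⟩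
            rw [← v.valuationOfNeZero_eq, h]
            rfl
          · exact hout v hv x hx)
      exact ⟨Additive.ofMul u, congrArg Additive.ofMul hu⟩
    have : IsNoetherian ℤ (LinearMap.range g) := isNoetherian_of_surjective g.rangeRestrict
      (LinearMap.range_eq_top.2 g.surjective_rangeRestrict)
    exact (isNoetherian_submodule.1 this) _ hle
  obtain ⟨u, hu⟩ := hfg
  have hex (x : Additive Kˣ) : ∃ n : ℕ, 0 < n ∧ (x ∈ N → x.toMul ^ n ∈ G) := by
    by_cases hx : x ∈ N
    · obtain ⟨n, hn, h⟩ := hx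
      exact ⟨n, hn, fun _ ↦ h⟩
    · exact ⟨1, one_pos, fun h ↦ (hx h).elim⟩
  choose e he0 he using hex
  refine ⟨∏ x ∈ u, e x, Finset.prod_pos fun x _ ↦ he0 x, fun c n hn hc ↦ ?_⟩
  let P : Submodule ℤ (Additive Kˣ) :=
    (AddSubgroup.toIntSubmodule (Subgroup.toAddSubgroup G)).comap
      (LinearMap.lsmul ℤ (Additive Kˣ) ((∏ x ∈ u, e x : ℕ) : ℤ))
  have hP (x : Additive Kˣ) : x ∈ P ↔ x.toMul ^ (∏ x ∈ u, e x) ∈ G := by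
    rw [← zpow_natCast]
    rfl
  have hle : N ≤ P := by
    rw [← hu, Submodule.span_le]
    intro x hx
    rw [SetLike.mem_coe, hP]
    obtain ⟨m, hm⟩ := Finset.dvd_prod_of_mem e hx
    rw [hm, pow_mul]
    exact pow_mem (he x (hu ▸ Submodule.subset_span hx)) m
  exact (hP (Additive.ofMul c)).1 (hle ⟨n, hn, hc⟩)

/-! ### Kummer theory and counting characters. -/

/-- On this set m x has a fixed residue mod t, so x is determined by ⌊m x / t⌋, which is less than
m. -/
theorem Finset.card_filter_dvd_mul_sub_le {t m : ℕ} (ht : 0 < t) (hm : 0 < m) (b : ℤ) :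
    ((Finset.range t).filter fun x : ℕ ↦ (t : ℤ) ∣ m * (x - b)).card ≤ m := by
  conv_rhs => rw [← Finset.card_range m]
  refine Finset.card_le_card_of_injOn (fun x ↦ m * x / t) (fun x hx ↦ ?_) fun x hx y hy hxy ↦ ?_
  · have hx := (Finset.mem_filter.1 hx).1
    simp only [Finset.coe_range, Set.mem_Iio, Finset.mem_range] at hx ⊢
    exact (Nat.div_lt_iff_lt_mul ht).2 (Nat.mul_lt_mul_of_pos_left hx hm)
  · have hx : (t : ℤ) ∣ m * (x - b) := (Finset.mem_filter.1 hx).2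
    have hy : (t : ℤ) ∣ m * (y - b) := (Finset.mem_filter.1 hy).2
    have h : ((m * x : ℕ) : ℤ) ≡ (m * y : ℕ) [ZMOD t] := by
      refine Int.ModEq.symm (Int.modEq_iff_dvd.2 ?_)
      have h := dvd_sub hx hy
      rw [← mul_sub, sub_sub_sub_cancel_right, mul_sub] at h
      rwa [Nat.cast_mul, Nat.cast_mul]
    have h' : m * x % t = m * y % t := Int.natCast_modEq_iff.1 h
    have hxy : m * x / t = m * y / t := hxy
    have : m * x = m * y := by
      rw [← Nat.div_add_mod (m * x) t, ← Nat.div_add_mod (m * y) t, hxy, h']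
    exact Nat.eq_of_mul_eq_mul_left hm this

/-- Dedekind: distinct characters are linearly independent in the space of functions G → L, of
dimension |G|. -/
theorem MonoidHom.finset_card_le_natCard {G L : Type*} [Group G] [Finite G] [Field L]
    (s : Finset (G →* Lˣ)) : s.card ≤ Nat.card G := by
  have : Fintype G := Fintype.ofFinite G
  have hinj : Function.Injective fun f : s ↦ (Units.coeHom L).comp f.1 := by
    intro f g hfg
    refine Subtype.ext (MonoidHom.ext fun x ↦ Units.ext ?_)
    exact DFunLike.congr_fun hfg x
  have h := ((linearIndependent_monoidHom G L).comp _ hinj).fintype_card_le_finrank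
  rwa [Fintype.card_coe, Module.finrank_fintype_fun_eq_card, ← Nat.card_eq_fintype_card] at h

section Kummer

variable {L F ι : Type*} [Field L] [Field F] [Algebra L F] {n : ℕ} {ζ : L} {t : ι → ℕ} {β : ι → F} {a : ι → L}

/-- The Kummer characters attached to radicals over a field with enough roots of unity. -/
theorem exists_kummer_characters [NeZero n] (hζ : IsPrimitiveRoot ζ n) (ht : ∀ i, t i ∣ n)
    (hβ : ∀ i, β i ≠ 0) (ha : ∀ i, β i ^ t i = algebraMap L F (a i)) :
    ∃ χ : ι → ((F ≃ₐ[L] F) →* Lˣ),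
      (∀ i σ, σ (β i) = algebraMap L F (χ i σ) * β i) ∧ ∀ i σ, χ i σ ^ t i = 1 := by
  have hex (i : ι) (σ : F ≃ₐ[L] F) : ∃ u : Lˣ, σ (β i) = algebraMap L F u * β i := by
    have h1 : (σ (β i) / β i) ^ t i = 1 := by
      rw [div_pow, ← map_pow, ha, AlgEquiv.commutes, ← ha, div_self (pow_ne_zero _ (hβ i))]
    have h2 : (σ (β i) / β i) ^ n = 1 := by
      obtain ⟨k, hk⟩ := ht i
      rw [hk, pow_mul, h1, one_pow]
    obtain ⟨j, -, hj⟩ := (hζ.map_of_injective (algebraMap L F).injective).eq_pow_of_pow_eq_one h2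
    refine ⟨(hζ.isUnit (NeZero.ne n)).unit ^ j, ?_⟩
    rw [Units.val_pow_eq_pow_val, IsUnit.unit_spec, map_pow, hj, div_mul_cancel₀ _ (hβ i)]
  choose u hu using hex
  refine ⟨fun i ↦ MonoidHom.mk' (u i) fun σ τ ↦ ?_, hu, fun i σ ↦ ?_⟩
  · refine Units.ext ((algebraMap L F).injective (mul_right_cancel₀ (hβ i) ?_))
    rw [← hu, AlgEquiv.mul_apply, hu i τ, map_mul, AlgEquiv.commutes, hu i σ, Units.val_mul,
      map_mul]
    ring
  · refine Units.ext ((algebraMap L F).injective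
      (mul_right_cancel₀ (pow_ne_zero (t i) (hβ i)) ?_))
    show algebraMap L F ((u i σ ^ t i : Lˣ) : L) * _ = _
    rw [Units.val_pow_eq_pow_val, map_pow, ← mul_pow, ← hu, ← map_pow, ha, AlgEquiv.commutes]
    simp

variable [FiniteDimensional L F] [IsGalois L F] [Fintype ι]

theorem finrank_dvd_prod_of_adjoin_radicals [NeZero n] (hζ : IsPrimitiveRoot ζ n)
    (ht : ∀ i, t i ∣ n) (hβ : ∀ i, β i ≠ 0) (ha : ∀ i, β i ^ t i = algebraMap L F (a i))
    (htop : IntermediateField.adjoin L (Set.range β) = ⊤) :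
    Module.finrank L F ∣ ∏ i, t i := by
  obtain ⟨χ, hχ, hχt⟩ := exists_kummer_characters hζ ht hβ ha
  let f : (F ≃ₐ[L] F) →* (∀ i, rootsOfUnity (t i) L) :=
    MonoidHom.pi fun i ↦ (χ i).codRestrict _ fun σ ↦ (mem_rootsOfUnity _ _).2 (hχt i σ)
  have hf : Function.Injective f := by
    refine (injective_iff_map_eq_one f).2 fun σ hσ ↦ ?_
    have hfix (i : ι) : σ (β i) = β i := by
      have h : χ i σ = 1 := congrArg Subtype.val (congrFun hσ i)
      rw [hχ, h, Units.val_one, map_one, one_mul]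
    have hle : IntermediateField.adjoin L (Set.range β) ≤
        IntermediateField.fixedField (Subgroup.zpowers σ) := by
      rw [IntermediateField.adjoin_le_iff]
      rintro _ ⟨i, rfl⟩
      rw [SetLike.mem_coe, IntermediateField.mem_fixedField_iff]
      exact fun τ hτ ↦ (Subgroup.zpowers_le.2
        (show σ ∈ MulAction.stabilizer (F ≃ₐ[L] F) (β i) from hfix i) hτ)
    ext x
    have hx := hle (htop ▸ IntermediateField.mem_top (x := x))
    exact (IntermediateField.mem_fixedField_iff _ _).1 hx σ (Subgroup.mem_zpowers σ)
  have hcard : Nat.card (∀ i, rootsOfUnity (t i) L) = ∏ i, t i := by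
    rw [Nat.card_pi]
    refine Finset.prod_congr rfl fun i _ ↦ ?_
    obtain ⟨k, hk⟩ := ht i
    have : NeZero (t i) := ⟨fun h ↦ NeZero.ne n (by rw [hk, h, zero_mul])⟩
    exact (hζ.pow (NeZero.pos n) (hk.trans (mul_comm _ _))).card_rootsOfUnity
  have h := Subgroup.card_dvd_of_injective f hf
  rwa [IsGalois.card_aut_eq_finrank, hcard] at h

theorem prod_le_pow_mul_finrank_of_radicals [NeZero n] (hζ : IsPrimitiveRoot ζ n)
    (ht : ∀ i, t i ∣ n) (hβ : ∀ i, β i ≠ 0) (ha : ∀ i, β i ^ t i = algebraMap L F (a i))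
    {m : ℕ} (hm : 0 < m)
    (hrel : ∀ e : ι → ℤ, ∏ i, β i ^ e i ∈ Set.range (algebraMap L F) →
      ∀ i, (t i : ℤ) ∣ m * e i) :
    ∏ i, t i ≤ m ^ Fintype.card ι * Module.finrank L F := by
  classical
  obtain ⟨χ, hχ, -⟩ := exists_kummer_characters hζ ht hβ ha
  have htpos (i : ι) : 0 < t i := Nat.pos_of_dvd_of_pos (ht i) (NeZero.pos n)
  let A : Finset (ι → ℕ) := Fintype.piFinset fun i ↦ Finset.range (t i)
  let Φ : (ι → ℕ) → ((F ≃ₐ[L] F) →* Lˣ) := fun e ↦ ∏ i, χ i ^ e i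
  have hΦ (e : ι → ℕ) (σ : F ≃ₐ[L] F) :
      σ (∏ i, β i ^ e i) = algebraMap L F (Φ e σ) * ∏ i, β i ^ e i := by
    have : Φ e σ = ∏ i, χ i σ ^ e i := by simp [Φ, MonoidHom.finsetProd_apply]
    rw [this, Units.coe_prod, map_prod, map_prod, ← Finset.prod_mul_distrib]
    refine Finset.prod_congr rfl fun i _ ↦ ?_
    rw [map_pow, hχ, mul_pow, Units.val_pow_eq_pow_val, map_pow]
  -- Equal characters make the quotient of the two monomials Galois-invariant, hence an element of
  -- L.
  have hfib (e e' : ι → ℕ) (h : Φ e = Φ e') (i : ι) : (t i : ℤ) ∣ m * (e i - e' i) := by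
    refine hrel (fun i ↦ (e i : ℤ) - e' i) ?_ i
    refine (IsGalois.mem_range_algebraMap_iff_fixed _).2 fun σ ↦ ?_
    have hz : ∏ i, β i ^ ((e i : ℤ) - e' i) = (∏ i, β i ^ e i) / ∏ i, β i ^ e' i := by
      rw [← Finset.prod_div_distrib]
      exact Finset.prod_congr rfl fun i _ ↦ by
        rw [zpow_sub₀ (hβ i), zpow_natCast, zpow_natCast]
    rw [hz, map_div₀, hΦ, hΦ, h, mul_div_mul_left]
    simp
  have hA : A.card = ∏ i, t i := by simp [A]
  rw [← hA, ← IsGalois.card_aut_eq_finrank L F]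
  refine (Finset.card_le_mul_card_image (f := Φ) A (m ^ Fintype.card ι) fun ψ hψ ↦ ?_).trans
    (Nat.mul_le_mul_left _ (MonoidHom.finset_card_le_natCard _))
  obtain ⟨e', -, rfl⟩ := Finset.mem_image.1 hψ
  calc (A.filter fun e ↦ Φ e = Φ e').card
      ≤ (Fintype.piFinset fun i ↦ (Finset.range (t i)).filter
          fun x : ℕ ↦ (t i : ℤ) ∣ m * (x - (e' i : ℤ))).card := by
        refine Finset.card_le_card fun e he ↦ ?_
        obtain ⟨heA, he⟩ := Finset.mem_filter.1 he
        refine Fintype.mem_piFinset.2 fun i ↦ Finset.mem_filter.2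
          ⟨Fintype.mem_piFinset.1 heA i, hfib e e' he i⟩
    _ = ∏ i, ((Finset.range (t i)).filter
          fun x : ℕ ↦ (t i : ℤ) ∣ m * (x - (e' i : ℤ))).card := Fintype.card_piFinset _
    _ ≤ ∏ _i : ι, m := Finset.prod_le_prod' fun i _ ↦
        Finset.card_filter_dvd_mul_sub_le (htpos i) hm _
    _ = m ^ Fintype.card ι := by simp

end Kummer

/-! ### Independence of the αᵢ, field degrees and the uniform bound. -/

/-- ℤ^ι maps onto the subgroup; equal ranks leave a kernel of rank 0, which vanishes inside a free
module. -/
theorem eq_zero_of_prod_zpow_eq_one_of_finrank_closure {G ι : Type*} [CommGroup G] [Fintype ι]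
    {α : ι → G}
    (hα : Module.finrank ℤ (Additive (Subgroup.closure (Set.range α))) = Fintype.card ι)
    {e : ι → ℤ} (he : ∏ i, α i ^ e i = 1) : e = 0 := by
  let v : ι → Additive (Subgroup.closure (Set.range α)) := fun i ↦
    Additive.ofMul ⟨α i, Subgroup.subset_closure (Set.mem_range_self i)⟩
  let f := Fintype.linearCombination ℤ v
  have hf (e : ι → ℤ) : (((f e).toMul : Subgroup.closure (Set.range α)) : G) = ∏ i, α i ^ e i := by
    simp [f, v, Fintype.linearCombination_apply, toMul_sum]
  have hsurj : LinearMap.range f = ⊤ := by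
    refine LinearMap.range_eq_top.2 fun x ↦ ?_
    obtain ⟨e, he⟩ := Subgroup.mem_closure_range_iff_of_fintype.1 x.toMul.2
    exact ⟨e, Additive.toMul.injective (Subtype.ext ((hf e).trans he.symm))⟩
  have hker : Module.finrank ℤ (LinearMap.ker f) = 0 := by
    have h := (LinearMap.ker f).finrank_quotient_add_finrank
    rw [f.quotKerEquivRange.finrank_eq, hsurj, finrank_top, hα, Module.finrank_fintype_fun_eq_card] at h
    omega
  rw [Submodule.finrank_eq_zero] at hker
  have hmem : e ∈ LinearMap.ker f :=
    Additive.toMul.injective (Subtype.ext ((hf e).trans he))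
  rwa [hker, Submodule.mem_bot] at hmem

theorem isGalois_adjoin_radicals {L Ω ι : Type*} [Field L] [CharZero L] [Field Ω] [Algebra L Ω]
    [Normal L Ω] {n : ℕ} [NeZero n] {ζ : L} (hζ : IsPrimitiveRoot ζ n) {t : ι → ℕ}
    (ht : ∀ i, t i ∣ n) {β : ι → Ω} {a : ι → L} (hβ : ∀ i, β i ≠ 0)
    (ha : ∀ i, β i ^ t i = algebraMap L Ω (a i)) :
    IsGalois L (IntermediateField.adjoin L (Set.range β)) := by
  have : Normal L (IntermediateField.adjoin L (Set.range β)) := by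
    rw [IntermediateField.normal_iff_forall_map_le']
    intro σ
    rw [IntermediateField.adjoin_map, IntermediateField.adjoin_le_iff]
    rintro _ ⟨_, ⟨i, rfl⟩, rfl⟩
    have h2 : (σ (β i) / β i) ^ n = 1 := by
      obtain ⟨k, hk⟩ := ht i
      rw [hk, pow_mul, div_pow, ← map_pow, ha, AlgEquiv.commutes, ← ha,
        div_self (pow_ne_zero _ (hβ i)), one_pow]
    obtain ⟨j, -, hj⟩ := (hζ.map_of_injective (algebraMap L Ω).injective).eq_pow_of_pow_eq_one h2
    have h3 : σ (β i) = algebraMap L Ω (ζ ^ j) * β i := by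
      rw [map_pow, hj, div_mul_cancel₀ _ (hβ i)]
    show σ (β i) ∈ IntermediateField.adjoin L (Set.range β)
    rw [h3]
    exact mul_mem (IntermediateField.algebraMap_mem _ _)
      (IntermediateField.subset_adjoin _ _ (Set.mem_range_self i))
  exact ⟨⟩

theorem totient_le_finrank_mul_finrank_adjoin {K Ω : Type*} [Field K] [NumberField K] [Field Ω]
    [Algebra K Ω] {n : ℕ} (hn : 0 < n) {ζ : Ω} (hζ : IsPrimitiveRoot ζ n) :
    n.totient ≤ Module.finrank ℚ K * Module.finrank K (IntermediateField.adjoin K {ζ}) := by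
  have hint : IsIntegral K ζ := (hζ.isIntegral hn).tower_top
  have : FiniteDimensional K (IntermediateField.adjoin K {ζ}) :=
    IntermediateField.adjoin.finiteDimensional hint
  have : CharZero Ω := charZero_of_injective_algebraMap (algebraMap K Ω).injective
  have : FiniteDimensional ℚ (IntermediateField.adjoin K {ζ}) := FiniteDimensional.trans ℚ K _
  let z : IntermediateField.adjoin K {ζ} := IntermediateField.AdjoinSimple.gen K ζ
  have hz : IsPrimitiveRoot z n :=
    IsPrimitiveRoot.of_map_of_injective (f := algebraMap (IntermediateField.adjoin K {ζ}) Ω)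
      hζ (FaithfulSMul.algebraMap_injective _ _)
  rw [Module.finrank_mul_finrank, ← Polynomial.natDegree_cyclotomic n ℚ,
    Polynomial.cyclotomic_eq_minpoly_rat hz hn]
  exact minpoly.natDegree_le z

theorem IntermediateField.relfinrank_restrictScalars {K Ω : Type*} [Field K] [Field Ω]
    [Algebra K Ω] (E : IntermediateField K Ω) (M : IntermediateField E Ω) :
    IntermediateField.relfinrank E (M.restrictScalars K) = Module.finrank E M := by
  have h : E ≤ M.restrictScalars K := fun x hx ↦ M.algebraMap_mem ⟨x, hx⟩
  rw [IntermediateField.relfinrank_eq_finrank_of_le h]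
  rfl

/-- A positive integer `m`, depending only on `α`, such that every relation among the radicals
`β i = α i ^ (1 / t i)` modulo `K(ζₙ)ˣ` is `m`-torsion. -/
theorem exists_uniform_bound_radical_relations {K ι : Type*} [Field K] [NumberField K] [Fintype ι]
    {α : ι → Kˣ}
    (hα : Module.finrank ℤ (Additive (Subgroup.closure (Set.range α))) = Fintype.card ι) :
    ∃ m : ℕ, 0 < m ∧ ∀ (L : Type _) [Field L] [Algebra K L] (n : ℕ) [NeZero n]
      [IsCyclotomicExtension {n} K L] (ζ : L) (t : ι → ℕ) (F : Type _) [Field F] [Algebra K F]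
      [Algebra L F] [IsScalarTower K L F] (β : ι → F), IsPrimitiveRoot ζ n → (∀ i, t i ∣ n) →
      (∀ i, β i ^ t i = algebraMap K F (α i)) →
      ∀ e : ι → ℤ, ∏ i, β i ^ e i ∈ Set.range (algebraMap L F) → ∀ i, (t i : ℤ) ∣ m * e i := by
  obtain ⟨D, hD, hD'⟩ := NumberField.exists_pow_mem_of_pow_mem (Set.finite_range α)
  refine ⟨D * NumberField.Units.torsionOrder K,
    Nat.mul_pos hD (NumberField.Units.torsionOrder_pos K), ?_⟩
  intro L _ _ n _ _ ζ t F _ _ _ _ β hζ ht hβ e he i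
  obtain ⟨γ, hγ⟩ := he
  choose s hs using ht
  have : FiniteDimensional K L := IsCyclotomicExtension.finiteDimensional {n} K L
  have : IsGalois K L := IsCyclotomicExtension.isGalois {n} K L
  have hγn : γ ^ n = algebraMap K L ((∏ i, α i ^ (s i * e i) : Kˣ) : K) := by
    refine (algebraMap L F).injective ?_
    rw [← IsScalarTower.algebraMap_apply, map_pow, hγ, ← Finset.prod_pow, Units.coe_prod, map_prod]
    refine Finset.prod_congr rfl fun i _ ↦ ?_
    rw [Units.val_zpow_eq_zpow_val, map_zpow₀, ← hβ, ← zpow_natCast, ← zpow_natCast, ← zpow_mul,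
      ← zpow_mul]
    congr 1
    rw [hs i]
    push_cast
    ring
  obtain ⟨c, hc⟩ := exists_pow_torsionOrder_eq_pow hζ hγn
  have hcG : c ^ n ∈ Subgroup.closure (Set.range α) := by
    rw [← hc]
    exact pow_mem (prod_mem fun i _ ↦ zpow_mem
      (Subgroup.subset_closure (Set.mem_range_self i)) _) _
  obtain ⟨h, hh⟩ :=
    Subgroup.mem_closure_range_iff_of_fintype.1 (hD' c n (NeZero.pos n) hcG)
  -- Both exponent vectors express c^(nD) in terms of the αᵢ.
  have key : (fun i ↦ (s i * e i) * (NumberField.Units.torsionOrder K * D : ℕ) - h i * n) = 0 := by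
    refine eq_zero_of_prod_zpow_eq_one_of_finrank_closure hα ?_
    simp only [zpow_sub, zpow_mul _ _ ((_ : ℕ) : ℤ), zpow_natCast]
    rw [Finset.prod_mul_distrib, Finset.prod_inv_distrib, Finset.prod_pow, Finset.prod_pow, ← hh,
      pow_mul, hc, pow_right_comm, mul_inv_cancel]
  have hi := congrFun key i
  have hs0 : (s i : ℤ) ≠ 0 := by
    intro h0
    have := hs i
    rw [Int.natCast_eq_zero.1 h0, mul_zero] at this
    exact NeZero.ne n this
  refine ⟨h i, mul_left_cancel₀ hs0 ?_⟩
  have hn : (n : ℤ) = t i * s i := by exact_mod_cast hs i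
  simp only [hn, Pi.zero_apply] at hi
  push_cast at hi ⊢
  linear_combination hi

theorem mainTheorem5 (K : Type*) [Field K] [NumberField K] (r : ℕ) (hr : 0 < r) (α : Fin r → Kˣ)
    (hα : Module.finrank ℤ (Additive (Subgroup.closure (Set.range α))) = r) :
    ∃ B : ℕ, 1 ≤ B ∧
      ∀ (n : ℕ) (t : Fin r → ℕ), 0 < n → (∀ i, 0 < t i) → (∀ i, t i ∣ n) →
        ∀ (ζ : AlgebraicClosure K) (β : Fin r → AlgebraicClosure K),
          IsPrimitiveRoot ζ n →
          (∀ i, β i ^ t i = algebraMap K (AlgebraicClosure K) (α i : K)) →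
          (kummerDegree K ζ β ∣ ∏ i, t i) ∧
          ((∏ i, t i) / kummerDegree K ζ β ∣ B) ∧
          ((Nat.totient n : ℚ) * (∏ i, (t i : ℚ)) / ((Module.finrank ℚ K : ℚ) * (B : ℚ)) ≤
            (Module.finrank K (cyclotomicKummerField K ζ β) : ℚ)) := by
  obtain ⟨m, hm, hrel⟩ := exists_uniform_bound_radical_relations (hα.trans (Fintype.card_fin r).symm)
  -- The ratio is only known to be at most m^r; the factorial turns this bound into divisibility.
  refine ⟨(m ^ r).factorial, Nat.factorial_pos _, fun n t hn htpos ht ζ β hζ hβ ↦ ?_⟩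
  have : NeZero n := ⟨hn.ne'⟩
  set E := IntermediateField.adjoin K {ζ} with hE
  have : IsCyclotomicExtension {n} K E := hζ.intermediateField_adjoin_isCyclotomicExtension K
  set M := IntermediateField.adjoin E (Set.range β) with hM
  have hKF : cyclotomicKummerField K ζ β = M.restrictScalars K := by
    rw [hM, hE, IntermediateField.adjoin_adjoin_left]
    rfl
  have hEF : E ≤ M.restrictScalars K := fun x hx ↦ M.algebraMap_mem ⟨x, hx⟩
  have hdeg : kummerDegree K ζ β = Module.finrank E M := by
    rw [kummerDegree, hKF]
    exact IntermediateField.relfinrank_restrictScalars E M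
  have hfin : Module.finrank K E * Module.finrank E M =
      Module.finrank K (cyclotomicKummerField K ζ β) := by
    rw [hKF, ← IntermediateField.relfinrank_restrictScalars E M]
    exact IntermediateField.finrank_bot_mul_relfinrank hEF
  have hβ0 (i : Fin r) : β i ≠ 0 := by
    intro h
    have := hβ i
    rw [h, zero_pow (htpos i).ne', eq_comm] at this
    exact (α i).ne_zero ((map_eq_zero _).1 this)
  let z : E := IntermediateField.AdjoinSimple.gen K ζ
  have hz : IsPrimitiveRoot z n :=
    IsPrimitiveRoot.of_map_of_injective (f := algebraMap E (AlgebraicClosure K)) hζ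
      (FaithfulSMul.algebraMap_injective _ _)
  have : Algebra.IsAlgebraic E (AlgebraicClosure K) := Algebra.IsAlgebraic.tower_top (K := K) E
  have hβE (i : Fin r) :
      β i ^ t i = algebraMap E (AlgebraicClosure K) (algebraMap K E (α i)) := by
    rw [hβ, ← IsScalarTower.algebraMap_apply]
  have : IsGalois E M := isGalois_adjoin_radicals hz ht hβ0 hβE
  have : FiniteDimensional E M :=
    have := (Set.finite_range β).to_subtype
    IntermediateField.finiteDimensional_adjoin fun x _ ↦ Algebra.IsIntegral.isIntegral x
  let b : Fin r → M := fun i ↦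
    ⟨β i, IntermediateField.subset_adjoin _ _ (Set.mem_range_self i)⟩
  have hb0 (i : Fin r) : b i ≠ 0 := fun h ↦ hβ0 i (congrArg Subtype.val h)
  have hbE (i : Fin r) : b i ^ t i = algebraMap E M (algebraMap K E (α i)) :=
    Subtype.ext (hβE i)
  have htop : IntermediateField.adjoin E (Set.range b) = ⊤ := by
    refine IntermediateField.lift_injective M ?_
    rw [IntermediateField.lift_adjoin, IntermediateField.lift_top, ← Set.range_comp]
    rfl
  have hdvd := finrank_dvd_prod_of_adjoin_radicals hz ht hb0 hbE htop
  have hle := prod_le_pow_mul_finrank_of_radicals hz ht hb0 hbE hm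
    (hrel E n z t M b hz ht fun i ↦ by rw [hbE, ← IsScalarTower.algebraMap_apply])
  rw [Fintype.card_fin] at hle
  have hpos : 0 < Module.finrank E M := Module.finrank_pos
  have hprod : 0 < ∏ i, t i := Finset.prod_pos fun i _ ↦ htpos i
  rw [hdeg, ← hfin]
  refine ⟨hdvd, Nat.dvd_factorial (Nat.div_pos (Nat.le_of_dvd hprod hdvd) hpos)
    (Nat.div_le_of_le_mul (by rwa [mul_comm])), ?_⟩
  have hK : 0 < Module.finrank ℚ K := Module.finrank_pos
  have hB := Nat.factorial_pos (m ^ r)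
  rw [div_le_iff₀ (by positivity)]
  have h1 := totient_le_finrank_mul_finrank_adjoin (K := K) hn hζ
  have h2 := hle.trans (Nat.mul_le_mul_right _ (Nat.self_le_factorial (m ^ r)))
  have h3 := Nat.mul_le_mul h1 h2
  calc (n.totient : ℚ) * ∏ i, (t i : ℚ) = ((n.totient * ∏ i, t i : ℕ) : ℚ) := by push_cast; rfl
    _ ≤ _ := Nat.cast_le.2 h3
    _ = _ := by push_cast; ring
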